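/- Fix the standard bases of finite-dimensional Hilbert spaces $\mathcal H_B$ and $\mathcal H_C$ as reference bases, and let $\mathcal H_A$ be a copy of $\mathcal H_C$, so that $d_A=d_C$. Transposes $(\cdot)^T$ are taken in the reference bases, and $|\phi_+\rangle=\frac{1}{\sqrt{d_C}}\sum_i|i\rangle_A|i\rangle_C$ is the maximally entangled vector. A density matrix (state) is a positive semidefinite matrix of trace $1$. A linear map is a real CPTP map if it is completely positive and trace preserving and has a finite Kraus representation in which every Kraus operator has real matrix entries in the reference bases. For an operator $M$ on $\mathcal H_R\otimes\mathcal H_S$ put $$H_{\min}(R|S)_M=-\log_2\inf\{\operatorname{tr}X:\ X\ge 0 \text{ on } \mathcal H_S,\ I_R\otimes X\ge M\}\in[-\infty,\infty],$$ where $Y\ge M$ means that $Y-M$ is positive semidefinite (in particular Hermitian), $\inf\emptyset=\infty$ and $\log_2 0=-\infty$. Let $\rho$ and $\sigma$ be density matrices on $\mathcal H_B$ and $\mathcal H_C$, respectively. For operators $\omega_1,\omega_2$ on $\mathcal H_A$ put $$\Omega=\Omega^{ABC}=\tfrac12\,\omega_1\otimes\rho\otimes\sigma+\tfrac12\,\omega_2\otimes\rho^T\otimes\sigma^T,$$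 with partial traces $\Omega^{AB}=\operatorname{tr}_C\Omega$ and $\Omega^{AC}=\operatorname{tr}_B\Omega$; write $H_{\min}(A|B)_\Omega$ and $H_{\min}(A|C)_\Omega$ for the conditional min-entropies of these two operators. Then the minimum $$\alpha=\min\Big\{\operatorname{tr}Z:\ I_A\otimes Z\ge X_1\otimes\rho+X_2\otimes\rho^T,\ \operatorname{tr}(\sigma^TX_1+\sigma X_2)=1,\ X_1,X_2\ge0\Big\}$$ over operators $X_1,X_2$ on $\mathcal H_A\cong\mathcal H_C$ and $Z$ on $\mathcal H_B$ is attained, and the following statements are equivalent: 1. There is a real CPTP map $\mathcal E$ with $\mathcal E(\rho)=\sigma$. 2. For all states $\omega_1,\omega_2$ on $\mathcal H_A$, $\;2^{-H_{\min}(A|B)_\Omega}\ge d_C\,\langle\phi_+|\Omega^{AC}|\phi_+\rangle$. 3. For all states $\omega_1,\omega_2$ on $\mathcal H_A$, $\;H_{\min}(A|B)_\Omega\le H_{\min}(A|C)_\Omega$. 4. For all operators $\omega_1,\omega_2$ on $\mathcal H_A$ (not necessarily states), $\;H_{\min}(A|B)_\Omega\le H_{\min}(A|C)_\Omega$. 5.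 $\alpha=1$. -/

import Mathlib

open scoped Kronecker ENNReal ComplexOrder

namespace RealOps

universe u v w

/-- A density matrix: positive semidefinite with unit trace. The standard basis of `ℂ^n` plays the
role of the fixed reference basis. -/
def IsDensity {n : Type u} [Fintype n] (ρ : Matrix n n ℂ) : Prop :=
  ρ.PosSemidef ∧ ρ.trace = 1

/-- The map `id_k ⊗ E`, applied block by block. -/
def ampliation {B : Type u} {C : Type v} (k : ℕ) (E : Matrix B B ℂ →ₗ[ℂ] Matrix C C ℂ)
    (X : Matrix (Fin k × B) (Fin k × B) ℂ) : Matrix (Fin k × C) (Fin k × C) ℂ :=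
  Matrix.of fun x y => E (Matrix.of fun p q => X (x.1, p) (y.1, q)) x.2 y.2

/-- Completely positive and trace preserving linear maps. -/
structure IsCPTP {B : Type u} {C : Type v} [Fintype B] [Fintype C]
    (E : Matrix B B ℂ →ₗ[ℂ] Matrix C C ℂ) : Prop where
  completelyPositive : ∀ (k : ℕ) (X : Matrix (Fin k × B) (Fin k × B) ℂ),
    X.PosSemidef → (ampliation k E X).PosSemidef
  tracePreserving : ∀ X : Matrix B B ℂ, (E X).trace = X.trace

/-- `E` is represented by finitely many Kraus operators all of whose entries in the reference basis
are real. -/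
def HasRealKraus {B : Type u} {C : Type v} [Fintype B]
    (E : Matrix B B ℂ →ₗ[ℂ] Matrix C C ℂ) : Prop :=
  ∃ (m : ℕ) (K : Fin m → Matrix C B ℂ),
    (∀ l i j, (K l i j).im = 0) ∧ ∀ X, E X = ∑ l, K l * X * (K l).conjTranspose

/-- A real CPTP map: a CPTP map with a real Kraus representation. -/
def IsRealCPTP {B : Type u} {C : Type v} [Fintype B] [Fintype C]
    (E : Matrix B B ℂ →ₗ[ℂ] Matrix C C ℂ) : Prop :=
  IsCPTP E ∧ HasRealKraus E

/-- `Ω^{ABC} = ½ ω₁ ⊗ ρ ⊗ σ + ½ ω₂ ⊗ ρᵀ ⊗ σᵀ`. -/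
noncomputable def Omega {A : Type u} {B : Type v} {C : Type w} (ω₁ ω₂ : Matrix A A ℂ)
    (ρ : Matrix B B ℂ) (σ : Matrix C C ℂ) : Matrix (A × B × C) (A × B × C) ℂ :=
  (1 / 2 : ℂ) • (ω₁ ⊗ₖ (ρ ⊗ₖ σ)) + (1 / 2 : ℂ) • (ω₂ ⊗ₖ (ρ.transpose ⊗ₖ σ.transpose))

/-- The marginal on `AB` (partial trace over `C`). -/
def marginalAB {A : Type u} {B : Type v} {C : Type w} [Fintype C]
    (M : Matrix (A × B × C) (A × B × C) ℂ) : Matrix (A × B) (A × B) ℂ :=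
  Matrix.of fun x y => ∑ k, M (x.1, x.2, k) (y.1, y.2, k)

/-- The marginal on `AC` (partial trace over `B`). -/
def marginalAC {A : Type u} {B : Type v} {C : Type w} [Fintype B]
    (M : Matrix (A × B × C) (A × B × C) ℂ) : Matrix (A × C) (A × C) ℂ :=
  Matrix.of fun x y => ∑ k, M (x.1, k, x.2) (y.1, k, y.2)

/-- The infimum of `tr X` over `X ≥ 0` with `1 ⊗ X ≥ M`; it is `∞` if no such `X` exists. -/
noncomputable def minTrace {R : Type u} {S : Type v} [Fintype R] [DecidableEq R] [Fintype S]
    (M : Matrix (R × S) (R × S) ℂ) : ℝ≥0∞ :=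
  ⨅ (X : Matrix S S ℂ) (_ : X.PosSemidef) (_ : ((1 : Matrix R R ℂ) ⊗ₖ X - M).PosSemidef),
    ENNReal.ofReal X.trace.re

/-- The conditional min-entropy `H_min(R|S)_M = -log₂ inf {tr X : X ≥ 0, 1 ⊗ X ≥ M}`, as an extended
real (`log₂ 0 = -∞`, `log₂ ∞ = ∞`). -/
noncomputable def condMinEntropy {R : Type u} {S : Type v} [Fintype R] [DecidableEq R] [Fintype S]
    (M : Matrix (R × S) (R × S) ℂ) : EReal :=
  -(ENNReal.log (minTrace M) / ((Real.log 2 : ℝ) : EReal))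

/-- `2 ^ x` for an extended real `x` (`2 ^ (-∞) = 0`, `2 ^ ∞ = ∞`). -/
noncomputable def twoPow (x : EReal) : ℝ≥0∞ :=
  EReal.exp (x * ((Real.log 2 : ℝ) : EReal))

/-- The maximally entangled vector `(1 / √d) ∑ i, |i⟩|i⟩` on `A ⊗ C`, where `A` is a copy of `C` and
`d` is their common dimension. -/
noncomputable def maxEntangled (C : Type u) [Fintype C] [DecidableEq C] : C × C → ℂ :=
  fun p => if p.1 = p.2 then ((1 / Real.sqrt (Fintype.card C) : ℝ) : ℂ) else 0

/-- The quantity `d ⟨φ₊| M |φ₊⟩`. -/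
noncomputable def maxEntangledOverlap {C : Type u} [Fintype C] [DecidableEq C]
    (M : Matrix (C × C) (C × C) ℂ) : ℝ :=
  (Fintype.card C : ℝ) *
    (dotProduct (star (maxEntangled C)) (M.mulVec (maxEntangled C))).re

/-- The values `tr Z` of the objective at the feasible points `(X₁, X₂, Z)` of the semidefinite
program; `X₁, X₂` act on `A`, a copy of `C`, and `Z` acts on `B`. -/
def sdpValues {B : Type u} {C : Type v} [Fintype B] [Fintype C] [DecidableEq C]
    (ρ : Matrix B B ℂ) (σ : Matrix C C ℂ) : Set ℝ :=
  {t | ∃ (X₁ X₂ : Matrix C C ℂ) (Z : Matrix B B ℂ),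
    X₁.PosSemidef ∧ X₂.PosSemidef ∧
    ((1 : Matrix C C ℂ) ⊗ₖ Z - (X₁ ⊗ₖ ρ + X₂ ⊗ₖ ρ.transpose)).PosSemidef ∧
    (σ.transpose * X₁ + σ * X₂).trace = 1 ∧
    (t : ℂ) = Z.trace}

end RealOps

/-! The equivalence is a cycle 1 → 4 → 3 → 2 → 5 → 1 with two substantial links.

Data processing (1 → 4): a channel with real Kraus operators commutes with transposition, so `E ρ =
σ` gives `E ρᵀ = σᵀ`, and `id ⊗ E` sends the AB marginal of `Omega` to the AC marginal. It is
completely positive and trace preserving, so it carries every `X` dominating the first to an `E X`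
of equal trace dominating the second (`minTrace_marginalAC_le`). Step 3 → 2 tests a dominating `1 ⊗
X` on the maximally entangled vector.

For 2 → 5, a feasible point of the program is averaged with its transpose and rescaled, so that its
`X` part becomes a pair of states; statement 2 for this pair then says `tr Z ≥ 1`
(`one_le_trace_of_overlap_le`). An explicit point of value 1 gives `α ≤ 1`.

Duality (5 → 1): real channels correspond to real positive semidefinite Choi matrices `J` with
`choiMarginal J = 1`. If none maps `ρ` to `σ`, Hahn–Banach yields Hermitian `W`, `Y` separating
(`exists_separating`). Since `J` is real, they control only the symmetrized operator `½(M + Mᵀ)`,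
with `M = 1 ⊗ W + Y ⊗ ρᵀ`; this is where the transposed terms of the program come from. A shift by a
multiple of the identity turns `W`, `Y` into a feasible point violating `α = 1`. -/

namespace RealOps

/-! ### Positive semidefinite matrices and Kraus maps -/

section Basic

variable {R S B C ι : Type*} [Fintype ι]

open scoped MatrixOrder in
lemma exists_conjTranspose_mul_self {𝕜 n : Type*} [RCLike 𝕜] [Fintype n] {M : Matrix n n 𝕜}
    (hM : M.PosSemidef) : ∃ A : Matrix n n 𝕜, M = A.conjTranspose * A := by
  classical
  exact CStarAlgebra.nonneg_iff_eq_star_mul_self.1 hM.nonneg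

/-- Any matrix entry of a positive semidefinite matrix is bounded by the trace. -/
lemma norm_entry_le_trace {𝕜 n : Type*} [RCLike 𝕜] [Fintype n] {M : Matrix n n 𝕜}
    (hM : M.PosSemidef) (i j : n) : ‖M i j‖ ≤ RCLike.re M.trace := by
  obtain ⟨A, rfl⟩ := exists_conjTranspose_mul_self hM
  have hdiag : ∀ i, RCLike.re ((A.conjTranspose * A) i i) = ∑ k, ‖A k i‖ ^ 2 := by
    intro i
    simp only [Matrix.mul_apply, Matrix.conjTranspose_apply, map_sum]
    refine Finset.sum_congr rfl fun k _ => ?_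
    rw [RCLike.star_def, RCLike.conj_mul]
    norm_cast
  have htr : ∀ i, ∑ k, ‖A k i‖ ^ 2 ≤ RCLike.re (A.conjTranspose * A).trace := by
    intro i
    simp only [Matrix.trace, Matrix.diag_apply, map_sum, hdiag]
    exact Finset.single_le_sum (f := fun i => ∑ k, ‖A k i‖ ^ 2)
      (fun i _ => Finset.sum_nonneg fun k _ => sq_nonneg _) (Finset.mem_univ i)
  calc ‖(A.conjTranspose * A) i j‖ ≤ ∑ k, ‖A k i‖ * ‖A k j‖ := by
        rw [Matrix.mul_apply]
        refine (norm_sum_le _ _).trans (Finset.sum_le_sum fun k _ => ?_)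
        simp
    _ ≤ ∑ k, (‖A k i‖ ^ 2 + ‖A k j‖ ^ 2) / 2 := by
        refine Finset.sum_le_sum fun k _ => ?_
        nlinarith [sq_nonneg (‖A k i‖ - ‖A k j‖)]
    _ = (∑ k, ‖A k i‖ ^ 2 + ∑ k, ‖A k j‖ ^ 2) / 2 := by
        rw [← Finset.sum_div, Finset.sum_add_distrib]
    _ ≤ _ := by linarith [htr i, htr j]

lemma isClosed_posSemidef {𝕜 n : Type*} [RCLike 𝕜] [Fintype n] :
    IsClosed {M : Matrix n n 𝕜 | M.PosSemidef} := by
  simp only [Matrix.posSemidef_iff_dotProduct_mulVec, Set.ofPred_and, Set.ofPred_forall]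
  refine (isClosed_eq (by fun_prop) continuous_id).inter (isClosed_iInter fun x => ?_)
  exact isClosed_le continuous_const (by fun_prop)

/-- Positive semidefinite matrices of bounded trace form a compact set. -/
lemma isCompact_posSemidef_trace_le {𝕜 n : Type*} [RCLike 𝕜] [Fintype n] (r : ℝ) :
    IsCompact {M : Matrix n n 𝕜 | M.PosSemidef ∧ RCLike.re M.trace ≤ r} := by
  have hbox : IsCompact (Set.univ.pi fun _ : n => Set.univ.pi fun _ : n =>
      Metric.closedBall (0 : 𝕜) r) :=
    isCompact_univ_pi fun _ => isCompact_univ_pi fun _ => isCompact_closedBall _ _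
  refine hbox.of_isClosed_subset
    (isClosed_posSemidef.inter
      (isClosed_le (RCLike.continuous_re.comp continuous_id.matrix_trace) continuous_const)) ?_
  rintro M ⟨hM, hr⟩ i - j -
  simpa using (norm_entry_le_trace hM i j).trans hr

/-- If `1 ⊗ Z` is Hermitian and nonnegative, so is `Z`. -/
lemma posSemidef_of_one_kronecker [DecidableEq R] [Nonempty R] {Z : Matrix S S ℂ}
    (h : ((1 : Matrix R R ℂ) ⊗ₖ Z).PosSemidef) : Z.PosSemidef := by
  obtain ⟨r⟩ := ‹Nonempty R›
  have := h.submatrix (fun s : S => (r, s))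
  convert this using 1
  ext i j
  simp

/-- Map a block matrix blockwise. -/
def blockMap (E : Matrix B B ℂ →ₗ[ℂ] Matrix C C ℂ) :
    Matrix (R × B) (R × B) ℂ →ₗ[ℂ] Matrix (R × C) (R × C) ℂ where
  toFun X := Matrix.of fun x y => E (Matrix.of fun p q => X (x.1, p) (y.1, q)) x.2 y.2
  map_add' X Y := by
    ext x y
    change E (Matrix.of (fun p q => X (x.1, p) (y.1, q)) +
      Matrix.of fun p q => Y (x.1, p) (y.1, q)) x.2 y.2 = _
    rw [map_add]; rfl
  map_smul' c X := by
    ext x y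
    change E (c • Matrix.of (fun p q => X (x.1, p) (y.1, q))) x.2 y.2 = _
    rw [map_smul]; rfl

lemma blockMap_kronecker (E : Matrix B B ℂ →ₗ[ℂ] Matrix C C ℂ) (ω : Matrix R R ℂ)
    (X : Matrix B B ℂ) : blockMap E (ω ⊗ₖ X) = ω ⊗ₖ E X := by
  ext x y
  change E (ω x.1 y.1 • X) x.2 y.2 = _
  rw [map_smul]; rfl

/-- The completely positive map with Kraus operators `K`. -/
def krausMap [Fintype B] (K : ι → Matrix C B ℂ) :
    Matrix B B ℂ →ₗ[ℂ] Matrix C C ℂ where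
  toFun X := ∑ l, K l * X * (K l).conjTranspose
  map_add' X Y := by simp [Matrix.mul_add, Matrix.add_mul, Finset.sum_add_distrib]
  map_smul' c X := by simp [Finset.smul_sum]

lemma krausMap_apply [Fintype B] (K : ι → Matrix C B ℂ) (X : Matrix B B ℂ) :
    krausMap K X = ∑ l, K l * X * (K l).conjTranspose := rfl

lemma blockMap_krausMap [Fintype R] [Fintype B] [DecidableEq R] (K : ι → Matrix C B ℂ)
    (X : Matrix (R × B) (R × B) ℂ) :
    blockMap (krausMap K) X = ∑ l, ((1 : Matrix R R ℂ) ⊗ₖ K l) * X *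
      ((1 : Matrix R R ℂ) ⊗ₖ K l).conjTranspose := by
  ext x y
  change (∑ l, K l * (Matrix.of fun p q => X (x.1, p) (y.1, q)) * (K l).conjTranspose) x.2 y.2 = _
  simp only [Matrix.sum_apply]
  refine Finset.sum_congr rfl fun l _ => ?_
  simp [Matrix.mul_apply, Fintype.sum_prod_type, Matrix.one_apply, Finset.sum_mul,
    Finset.sum_ite_irrel, apply_ite]

lemma blockMap_krausMap_posSemidef [Fintype R] [Fintype B] [Fintype C]
    (K : ι → Matrix C B ℂ) {X : Matrix (R × B) (R × B) ℂ} (hX : X.PosSemidef) :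
    (blockMap (krausMap K) X).PosSemidef := by
  classical
  rw [blockMap_krausMap]
  exact Matrix.posSemidef_sum _ fun _ _ => hX.mul_mul_conjTranspose_same _

lemma krausMap_posSemidef [Fintype B] [Fintype C]
    (K : ι → Matrix C B ℂ) {X : Matrix B B ℂ} (hX : X.PosSemidef) :
    (krausMap K X).PosSemidef :=
  Matrix.posSemidef_sum _ fun _ _ => hX.mul_mul_conjTranspose_same _

/-- For a real matrix the adjoint is the transpose. This is the only use of realness in passing from
a channel to the entropy inequalities. -/
lemma krausMap_transpose [Fintype B] {K : ι → Matrix C B ℂ}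
    (hK : ∀ l i j, (K l i j).im = 0) (X : Matrix B B ℂ) :
    krausMap K X.transpose = (krausMap K X).transpose := by
  have h : ∀ l, (K l).conjTranspose = (K l).transpose := fun l => by
    ext i j
    simpa using Complex.conj_eq_iff_im.2 (hK l j i)
  simp only [krausMap_apply, Matrix.transpose_sum, Matrix.transpose_mul, h,
    Matrix.transpose_transpose, Matrix.mul_assoc]

end Basic

/-! ### Min-entropy and the maximally entangled overlap -/

section Entropy

variable {R : Type*} {S : Type*} [Fintype R] [DecidableEq R] [Fintype S]

lemma log_two_pos_EReal : (0 : EReal) < ((Real.log 2 : ℝ) : EReal) := by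
  exact_mod_cast Real.log_pos one_lt_two

lemma twoPow_neg_condMinEntropy (M : Matrix (R × S) (R × S) ℂ) :
    twoPow (-condMinEntropy M) = minTrace M := by
  rw [twoPow, condMinEntropy, neg_neg, EReal.div_mul_cancel (EReal.coe_ne_bot _)
    (EReal.coe_ne_top _) log_two_pos_EReal.ne', ENNReal.exp_log]

lemma condMinEntropy_le_condMinEntropy {R' S' : Type*} [Fintype R'] [DecidableEq R'] [Fintype S']
    {M : Matrix (R × S) (R × S) ℂ} {N : Matrix (R' × S') (R' × S') ℂ}
    (h : minTrace N ≤ minTrace M) : condMinEntropy M ≤ condMinEntropy N :=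
  EReal.neg_le_neg_iff.2
    (EReal.div_le_div_right_of_nonneg log_two_pos_EReal.le (ENNReal.log_le_log h))

lemma minTrace_le_of_condMinEntropy_le {R' S' : Type*} [Fintype R'] [DecidableEq R'] [Fintype S']
    {M : Matrix (R × S) (R × S) ℂ} {N : Matrix (R' × S') (R' × S') ℂ}
    (h : condMinEntropy M ≤ condMinEntropy N) : minTrace N ≤ minTrace M := by
  rw [← twoPow_neg_condMinEntropy, ← twoPow_neg_condMinEntropy]
  exact EReal.exp_monotone
    (mul_le_mul_of_nonneg_right (EReal.neg_le_neg_iff.2 h) log_two_pos_EReal.le)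

lemma minTrace_le {M : Matrix (R × S) (R × S) ℂ} {X : Matrix S S ℂ} (hX : X.PosSemidef)
    (h : ((1 : Matrix R R ℂ) ⊗ₖ X - M).PosSemidef) : minTrace M ≤ ENNReal.ofReal X.trace.re :=
  iInf_le_of_le X (iInf_le_of_le hX (iInf_le _ h))

lemma dotProduct_maxEntangled {C : Type*} [Fintype C] [DecidableEq C]
    (M : Matrix (C × C) (C × C) ℂ) :
    maxEntangledOverlap M = (∑ i, ∑ j, M (i, i) (j, j)).re := by
  rcases isEmpty_or_nonempty C with h | h
  · simp [maxEntangledOverlap]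
  have hc : (0 : ℝ) < Fintype.card C := by exact_mod_cast Fintype.card_pos
  have hs : ((Real.sqrt (Fintype.card C))⁻¹ : ℝ) * (Real.sqrt (Fintype.card C))⁻¹
      = (Fintype.card C : ℝ)⁻¹ := by
    rw [← mul_inv, Real.mul_self_sqrt hc.le]
  have hsum : dotProduct (star (maxEntangled C)) (M.mulVec (maxEntangled C)) =
      (((Fintype.card C : ℝ)⁻¹ : ℝ) : ℂ) * ∑ i, ∑ j, M (i, i) (j, j) := by
    rw [← hs]
    simp only [dotProduct, Matrix.mulVec, maxEntangled, Fintype.sum_prod_type, Pi.star_apply]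
    simp [apply_ite, Finset.mul_sum]
    refine Finset.sum_congr rfl fun i _ => Finset.sum_congr rfl fun j _ => ?_
    ring
  rw [maxEntangledOverlap, hsum, Complex.re_ofReal_mul, ← mul_assoc, mul_inv_cancel₀ hc.ne',
    one_mul]

/-- The overlap is linear, nonnegative on positive semidefinite matrices, and equals `tr X` at `1 ⊗
X`. -/
lemma maxEntangledOverlap_le_trace {C : Type*} [Fintype C] [DecidableEq C]
    {M : Matrix (C × C) (C × C) ℂ} {X : Matrix C C ℂ}
    (h : ((1 : Matrix C C ℂ) ⊗ₖ X - M).PosSemidef) : maxEntangledOverlap M ≤ X.trace.re := by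
  have h1 : 0 ≤ maxEntangledOverlap ((1 : Matrix C C ℂ) ⊗ₖ X - M) :=
    mul_nonneg (Nat.cast_nonneg _) (Complex.le_def.1 (h.dotProduct_mulVec_nonneg _)).1
  rw [dotProduct_maxEntangled] at h1 ⊢
  simpa [Matrix.one_apply, Matrix.trace] using h1

lemma maxEntangledOverlap_le_minTrace {C : Type*} [Fintype C] [DecidableEq C]
    (M : Matrix (C × C) (C × C) ℂ) :
    ENNReal.ofReal (maxEntangledOverlap M) ≤ minTrace M :=
  le_iInf fun _ => le_iInf fun _ => le_iInf fun h =>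
    ENNReal.ofReal_le_ofReal (maxEntangledOverlap_le_trace h)

end Entropy

/-! ### Marginals of `Omega` and data processing -/

section Marginals

variable {A B C : Type*}

lemma marginalAB_Omega [Fintype C] (ω₁ ω₂ : Matrix A A ℂ) (ρ : Matrix B B ℂ) {σ : Matrix C C ℂ}
    (hσ : σ.trace = 1) : marginalAB (Omega ω₁ ω₂ ρ σ) =
      (1 / 2 : ℂ) • (ω₁ ⊗ₖ ρ) + (1 / 2 : ℂ) • (ω₂ ⊗ₖ ρ.transpose) := by
  have h : ∑ k, σ k k = 1 := hσ
  ext x y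
  simp [marginalAB, Omega, Finset.sum_add_distrib, ← Finset.mul_sum, h]

lemma marginalAC_Omega [Fintype B] (ω₁ ω₂ : Matrix A A ℂ) {ρ : Matrix B B ℂ} (σ : Matrix C C ℂ)
    (hρ : ρ.trace = 1) : marginalAC (Omega ω₁ ω₂ ρ σ) =
      (1 / 2 : ℂ) • (ω₁ ⊗ₖ σ) + (1 / 2 : ℂ) • (ω₂ ⊗ₖ σ.transpose) := by
  have h : ∑ k, ρ k k = 1 := hρ
  ext x y
  simp [marginalAC, Omega, Finset.sum_add_distrib, ← Finset.mul_sum, ← Finset.sum_mul, h]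

/-- Links the overlap in statement 2 to the normalisation functional of the semidefinite program. -/
lemma overlap_marginalAC_Omega [Fintype B] [Fintype C] [DecidableEq C] (ω₁ ω₂ : Matrix C C ℂ) {ρ : Matrix B B ℂ}
    (σ : Matrix C C ℂ) (hρ : ρ.trace = 1) :
    maxEntangledOverlap (marginalAC (Omega ω₁ ω₂ ρ σ)) =
      (σ.transpose * ω₁ + σ * ω₂).trace.re / 2 := by
  have h : ∀ z : ℂ, z.re / 2 = ((1 / 2 : ℂ) * z).re := fun z => by
    rw [show (1 / 2 : ℂ) = ((1 / 2 : ℝ) : ℂ) by simp, Complex.re_ofReal_mul]; ring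
  rw [marginalAC_Omega _ _ _ hρ, dotProduct_maxEntangled, h]
  congr 1
  simp only [Matrix.trace, Matrix.diag_apply, Matrix.add_apply, Matrix.mul_apply,
    Matrix.smul_apply, Matrix.kroneckerMap_apply, Matrix.transpose_apply, smul_eq_mul,
    Finset.sum_add_distrib, Finset.mul_sum, mul_add]
  congr 1
  · rw [Finset.sum_comm]
    exact Finset.sum_congr rfl fun i _ => Finset.sum_congr rfl fun j _ => by ring
  · rw [Finset.sum_comm]
    exact Finset.sum_congr rfl fun i _ => Finset.sum_congr rfl fun j _ => by ring

/-- A real channel does not increase the trace needed to dominate the marginal of `Omega`. -/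
lemma minTrace_marginalAC_le [Fintype A] [Fintype B] [Fintype C] [DecidableEq A] {E : Matrix B B ℂ →ₗ[ℂ] Matrix C C ℂ}
    (hE : IsRealCPTP E) {ρ : Matrix B B ℂ} {σ : Matrix C C ℂ} (hρ : ρ.trace = 1)
    (hσ : σ.trace = 1) (hEρ : E ρ = σ) (ω₁ ω₂ : Matrix A A ℂ) :
    minTrace (marginalAC (Omega ω₁ ω₂ ρ σ)) ≤ minTrace (marginalAB (Omega ω₁ ω₂ ρ σ)) := by
  obtain ⟨m, K, hK, hEK⟩ := hE.2
  obtain rfl : E = krausMap K := LinearMap.ext hEK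
  refine le_iInf fun X => le_iInf fun hX => le_iInf fun h => ?_
  rw [← hE.1.tracePreserving X]
  refine minTrace_le (krausMap_posSemidef K hX) ?_
  convert blockMap_krausMap_posSemidef K h using 1
  rw [marginalAB_Omega _ _ _ hσ, marginalAC_Omega _ _ _ hρ]
  simp only [map_sub, map_add, map_smul, blockMap_kronecker, krausMap_transpose hK, hEρ]

end Marginals

end RealOps
namespace RealOps

/-! ### The semidefinite program: attainment and lower bound -/

section Program

variable {B C : Type*} [Fintype C] [DecidableEq C]

/-- Feasibility of `(X₁, X₂, Z)`, with the normalisation constraint set to the value `s`. -/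
structure Feasible (ρ : Matrix B B ℂ) (σ : Matrix C C ℂ) (s : ℝ) (X₁ X₂ : Matrix C C ℂ)
    (Z : Matrix B B ℂ) : Prop where
  left : X₁.PosSemidef
  right : X₂.PosSemidef
  le : ((1 : Matrix C C ℂ) ⊗ₖ Z - (X₁ ⊗ₖ ρ + X₂ ⊗ₖ ρ.transpose)).PosSemidef
  norm : (σ.transpose * X₁ + σ * X₂).trace = s

variable {ρ : Matrix B B ℂ} {σ : Matrix C C ℂ} {s : ℝ} {X₁ X₂ : Matrix C C ℂ} {Z : Matrix B B ℂ}

lemma mem_sdpValues [Fintype B] {t : ℝ} : t ∈ sdpValues ρ σ ↔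
    ∃ X₁ X₂ Z, Feasible ρ σ 1 X₁ X₂ Z ∧ (t : ℂ) = Z.trace := by
  constructor
  · rintro ⟨X₁, X₂, Z, h1, h2, h3, h4, h5⟩
    exact ⟨X₁, X₂, Z, ⟨h1, h2, h3, by simpa using h4⟩, h5⟩
  · rintro ⟨X₁, X₂, Z, ⟨h1, h2, h3, h4⟩, h5⟩
    exact ⟨X₁, X₂, Z, h1, h2, h3, by simpa using h4, h5⟩

/-- Positivity of `Z` is not imposed by the program; it follows because `1 ⊗ Z` dominates a positive
semidefinite matrix. -/
lemma Feasible.posSemidef [Fintype B] [Nonempty C] (h : Feasible ρ σ s X₁ X₂ Z) (hρ : ρ.PosSemidef) :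
    Z.PosSemidef := by
  refine posSemidef_of_one_kronecker (R := C) ?_
  have := h.le.add ((h.left.kronecker hρ).add (h.right.kronecker hρ.transpose))
  rwa [sub_add_cancel] at this

lemma Feasible.trace_le [Fintype B] (h : Feasible ρ σ s X₁ X₂ Z) (hρ : ρ.trace = 1) :
    X₁.trace.re + X₂.trace.re ≤ Fintype.card C * Z.trace.re := by
  have := (Complex.le_def.1 h.le.trace_nonneg).1
  simpa [Matrix.trace_sub, Matrix.trace_add, Matrix.trace_kronecker, hρ] using this

lemma Feasible.smul (h : Feasible ρ σ s X₁ X₂ Z) {a : ℝ} (ha : 0 ≤ a) :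
    Feasible ρ σ (a * s) ((a : ℂ) • X₁) ((a : ℂ) • X₂) ((a : ℂ) • Z) := by
  have ha' : (0 : ℂ) ≤ a := by exact_mod_cast ha
  refine ⟨h.left.smul ha', h.right.smul ha', ?_, ?_⟩
  · convert h.le.smul ha' using 1
    simp only [Matrix.kronecker_smul, Matrix.smul_kronecker, smul_sub, smul_add]
  · rw [Matrix.mul_smul, Matrix.mul_smul, ← smul_add, Matrix.trace_smul, h.norm]
    simp

/-- Transposition exchanges `ρ` and `ρᵀ`, so `(X₂ᵀ, X₁ᵀ, Zᵀ)` is again feasible. Adding it makes the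
two `X` components transposes of each other, hence of equal trace, so one scalar normalises both to
states. -/
lemma Feasible.add_transpose (h : Feasible ρ σ s X₁ X₂ Z) :
    Feasible ρ σ (2 * s) (X₁ + X₂.transpose) (X₁ + X₂.transpose).transpose
      (Z + Z.transpose) := by
  refine ⟨h.left.add h.right.transpose, (h.left.add h.right.transpose).transpose, ?_, ?_⟩
  · convert h.le.add h.le.transpose using 1
    simp only [Matrix.transpose_add, Matrix.transpose_sub, ← Matrix.kroneckerMap_transpose,
      Matrix.transpose_transpose, Matrix.transpose_one, Matrix.kronecker_add, Matrix.add_kronecker]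
    abel
  · have h1 := h.norm
    have h2 : (σ.transpose * X₂.transpose).trace = (σ * X₂).trace := by
      rw [← Matrix.transpose_mul, Matrix.trace_transpose, Matrix.trace_mul_comm]
    have h3 : (σ * X₁.transpose).trace = (σ.transpose * X₁).trace := by
      rw [← Matrix.trace_transpose, Matrix.transpose_mul, Matrix.transpose_transpose,
        Matrix.trace_mul_comm]
    simp only [Matrix.transpose_add, Matrix.transpose_transpose, Matrix.mul_add,
      Matrix.trace_add] at h1 ⊢
    rw [h2, h3]
    push_cast
    linear_combination 2 * h1

/-- The reference point with zero slack; for `tr ρ = 1` its objective value is 1. -/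
lemma feasible_half (hσ : σ.trace = 1) :
    Feasible ρ σ 1 ((1 / 2 : ℂ) • 1) ((1 / 2 : ℂ) • 1) ((1 / 2 : ℂ) • (ρ + ρ.transpose)) := by
  have h0 : (0 : ℂ) ≤ 1 / 2 := by
    rw [show (1 / 2 : ℂ) = ((1 / 2 : ℝ) : ℂ) by simp]; exact_mod_cast (by norm_num)
  refine ⟨Matrix.PosSemidef.one.smul h0, Matrix.PosSemidef.one.smul h0, ?_, ?_⟩
  · convert Matrix.PosSemidef.zero using 1
    simp [Matrix.kronecker_smul, Matrix.smul_kronecker, Matrix.kronecker_add]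
  · simp [Matrix.trace_add, hσ]
    norm_num

lemma isClosed_feasible [Fintype B] :
    IsClosed {p : Matrix C C ℂ × Matrix C C ℂ × Matrix B B ℂ |
      Feasible ρ σ s p.1 p.2.1 p.2.2} := by
  have h : {p : Matrix C C ℂ × Matrix C C ℂ × Matrix B B ℂ | Feasible ρ σ s p.1 p.2.1 p.2.2} =
      (fun p => p.1) ⁻¹' {M | M.PosSemidef} ∩ ((fun p => p.2.1) ⁻¹' {M | M.PosSemidef} ∩
      ((fun p => (1 : Matrix C C ℂ) ⊗ₖ p.2.2 - (p.1 ⊗ₖ ρ + p.2.1 ⊗ₖ ρ.transpose)) ⁻¹'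
        {M | M.PosSemidef} ∩
      {p | (σ.transpose * p.1 + σ * p.2.1).trace = (s : ℂ)})) := by
    ext p
    exact ⟨fun h => ⟨h.1, h.2, h.3, h.4⟩, fun h => ⟨h.1, h.2.1, h.2.2.1, h.2.2.2⟩⟩
  rw [h]
  refine (isClosed_posSemidef.preimage (by fun_prop)).inter
    ((isClosed_posSemidef.preimage (by fun_prop)).inter
    ((isClosed_posSemidef.preimage ?_).inter (isClosed_eq ?_ continuous_const)))
  · refine continuous_matrix fun i j => ?_
    simp only [Matrix.sub_apply, Matrix.add_apply, Matrix.kroneckerMap_apply]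
    fun_prop
  · exact Continuous.matrix_trace (by fun_prop)

lemma exists_isLeast_sdpValues [Fintype B] [Nonempty C] (hρ : IsDensity ρ) (hσ : IsDensity σ) :
    ∃ α, IsLeast (sdpValues ρ σ) α ∧ α ≤ 1 := by
  -- Cutting at the value of the reference point loses no minimiser, and `Feasible.trace_le` then
  -- bounds `X₁` and `X₂`, which gives compactness.
  set F := {p : Matrix C C ℂ × Matrix C C ℂ × Matrix B B ℂ |
      Feasible ρ σ 1 p.1 p.2.1 p.2.2} ∩ {p | p.2.2.trace.re ≤ 1} with hF
  have hcont : Continuous fun p : Matrix C C ℂ × Matrix C C ℂ × Matrix B B ℂ => p.2.2.trace.re :=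
    Complex.continuous_re.comp (Continuous.matrix_trace (by fun_prop))
  have hcomp : IsCompact F := by
    refine ((isCompact_posSemidef_trace_le (Fintype.card C : ℝ)).prod
      ((isCompact_posSemidef_trace_le (Fintype.card C : ℝ)).prod
        (isCompact_posSemidef_trace_le 1))).of_isClosed_subset
      (isClosed_feasible.inter (isClosed_le hcont continuous_const)) ?_
    rintro ⟨X₁, X₂, Z⟩ ⟨h, hZ⟩
    have h1 : X₁.trace.re + X₂.trace.re ≤ Fintype.card C * 1 :=
      (h.trace_le hρ.2).trans (mul_le_mul_of_nonneg_left hZ (Nat.cast_nonneg _))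
    have h2 := (Complex.le_def.1 h.left.trace_nonneg).1
    have h3 := (Complex.le_def.1 h.right.trace_nonneg).1
    simp only [Complex.zero_re] at h2 h3
    refine ⟨⟨h.left, ?_⟩, ⟨h.right, ?_⟩, h.posSemidef hρ.1, hZ⟩
    · change X₁.trace.re ≤ _; linarith
    · change X₂.trace.re ≤ _; linarith
  have hhalf : (((1 / 2 : ℂ) • 1, (1 / 2 : ℂ) • 1, (1 / 2 : ℂ) • (ρ + ρ.transpose)) :
      Matrix C C ℂ × Matrix C C ℂ × Matrix B B ℂ) ∈ F := by
    refine ⟨feasible_half hσ.2, ?_⟩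
    change (Matrix.trace ((1 / 2 : ℂ) • (ρ + ρ.transpose))).re ≤ 1
    simp [Matrix.trace_add, hρ.2]
    norm_num
  obtain ⟨⟨X₁, X₂, Z⟩, ⟨h, hZ⟩, hmin⟩ := hcomp.exists_isMinOn ⟨_, hhalf⟩ hcont.continuousOn
  refine ⟨Z.trace.re, ⟨mem_sdpValues.2 ⟨X₁, X₂, Z, h, ?_⟩, ?_⟩, hZ⟩
  · have := Complex.le_def.1 (h.posSemidef hρ.1).trace_nonneg
    exact Complex.ext rfl (by simpa using this.2)
  · intro t ht
    obtain ⟨Y₁, Y₂, W, hW, htW⟩ := mem_sdpValues.1 ht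
    have htr : W.trace.re = t := by rw [← htW, Complex.ofReal_re]
    rcases le_total t 1 with h1 | h1
    · have : Z.trace.re ≤ W.trace.re :=
        hmin (show ((Y₁, Y₂, W) : Matrix C C ℂ × Matrix C C ℂ × Matrix B B ℂ) ∈ F from
          ⟨hW, htr.trans_le h1⟩)
      exact this.trans htr.le
    · exact le_trans hZ h1

lemma isLeast_eq_one_iff [Fintype B] [Nonempty C] {α : ℝ} (hρ : IsDensity ρ) (hα : IsLeast (sdpValues ρ σ) α)
    (hα1 : α ≤ 1) :
    α = 1 ↔ ∀ X₁ X₂ Z, Feasible ρ σ 1 X₁ X₂ Z → 1 ≤ Z.trace.re := by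
  constructor
  · rintro rfl X₁ X₂ Z h
    refine hα.2 (mem_sdpValues.2 ⟨X₁, X₂, Z, h, ?_⟩)
    have := Complex.le_def.1 (h.posSemidef hρ.1).trace_nonneg
    exact Complex.ext rfl (by simpa using this.2)
  · intro h
    obtain ⟨X₁, X₂, Z, hf, hZ⟩ := mem_sdpValues.1 hα.1
    refine le_antisymm hα1 ?_
    simpa [← hZ] using h _ _ _ hf

/-- Entropic monotonicity bounds the value of the program from below. -/
lemma one_le_trace_of_overlap_le [Fintype B] [Nonempty C] (hρ : IsDensity ρ) (hσ : IsDensity σ)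
    (H : ∀ ω₁ ω₂ : Matrix C C ℂ, IsDensity ω₁ → IsDensity ω₂ →
      ((maxEntangledOverlap (marginalAC (Omega ω₁ ω₂ ρ σ)) : ℝ) : EReal) ≤
        ((minTrace (marginalAB (Omega ω₁ ω₂ ρ σ)) : ENNReal) : EReal))
    (h : Feasible ρ σ 1 X₁ X₂ Z) : 1 ≤ Z.trace.re := by
  have h' := h.add_transpose
  set X := X₁ + X₂.transpose with hX
  have htX := Complex.le_def.1 h'.left.trace_nonneg
  set t : ℝ := X.trace.re with ht
  have hXt : X.trace = t := Complex.ext rfl (by simpa using htX.2.symm)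
  -- Trace zero would force `X = 0`, against the normalisation value 2.
  have htpos : 0 < t := by
    refine lt_of_le_of_ne htX.1 fun h0 => ?_
    have hX0 : X = 0 := h'.left.trace_eq_zero_iff.1 (by rw [hXt, ← h0]; simp)
    have := h'.norm
    simp [hX0] at this
  have hinv : (0 : ℂ) ≤ ((t⁻¹ : ℝ) : ℂ) := by exact_mod_cast (inv_pos.2 htpos).le
  have hω : IsDensity (((t⁻¹ : ℝ) : ℂ) • X) := by
    refine ⟨h'.left.smul hinv, ?_⟩
    rw [Matrix.trace_smul, hXt, smul_eq_mul, ← Complex.ofReal_mul, inv_mul_cancel₀ htpos.ne',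
      Complex.ofReal_one]
  have hω' : IsDensity (((t⁻¹ : ℝ) : ℂ) • X).transpose :=
    ⟨hω.1.transpose, (Matrix.trace_transpose _).trans hω.2⟩
  -- The factor `t⁻¹` produces states; the further `1 / 2` matches the weights in `Omega`. Statement
  -- 2 then reads `t⁻¹ ≤ t⁻¹ * tr Z`.
  have hs := h'.smul (inv_pos.2 htpos).le
  have hs2 := hs.smul (a := 1 / 2) (by norm_num)
  have hle := H _ _ hω hω'
  have hmin : minTrace (marginalAB (Omega (((t⁻¹ : ℝ) : ℂ) • X) (((t⁻¹ : ℝ) : ℂ) • X).transpose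
      ρ σ)) ≤ ENNReal.ofReal (t⁻¹ * Z.trace.re) := by
    have := minTrace_le (hs2.posSemidef hρ.1) (M := marginalAB
      (Omega (((t⁻¹ : ℝ) : ℂ) • X) (((t⁻¹ : ℝ) : ℂ) • X).transpose ρ σ)) (R := C) (by
        rw [marginalAB_Omega _ _ _ hσ.2]
        have := hs2.le
        simpa only [Matrix.smul_kronecker, Matrix.transpose_smul, Complex.ofReal_div,
          Complex.ofReal_one, Complex.ofReal_ofNat] using this)
    convert this using 2
    rw [Matrix.trace_smul, Matrix.trace_smul, Matrix.trace_add, Matrix.trace_transpose,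
      smul_eq_mul, smul_eq_mul, Complex.re_ofReal_mul, Complex.re_ofReal_mul, Complex.add_re]
    ring
  have hZ0 : 0 ≤ Z.trace.re := (Complex.le_def.1 (h.posSemidef hρ.1).trace_nonneg).1
  have hov : maxEntangledOverlap (marginalAC (Omega (((t⁻¹ : ℝ) : ℂ) • X)
      (((t⁻¹ : ℝ) : ℂ) • X).transpose ρ σ)) = t⁻¹ := by
    have := hs.norm
    rw [overlap_marginalAC_Omega _ _ _ hρ.2, Matrix.transpose_smul, this, Complex.ofReal_re]
    ring
  rw [hov] at hle
  have h1 := hle.trans (EReal.coe_ennreal_le_coe_ennreal_iff.2 hmin)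
  rw [EReal.coe_ennreal_ofReal, max_eq_left (mul_nonneg (inv_pos.2 htpos).le hZ0),
    EReal.coe_le_coe_iff] at h1
  exact le_of_mul_le_mul_left (by rwa [mul_one]) (inv_pos.2 htpos)

lemma Feasible.le_trace [Fintype B] (H : ∀ X₁ X₂ Z, Feasible ρ σ 1 X₁ X₂ Z → 1 ≤ Z.trace.re)
    (h : Feasible ρ σ s X₁ X₂ Z) (hs : 0 < s) : s ≤ Z.trace.re := by
  have h1 := h.smul (inv_pos.2 hs).le
  rw [inv_mul_cancel₀ hs.ne'] at h1
  have h2 := H _ _ _ h1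
  rw [Matrix.trace_smul, smul_eq_mul, Complex.re_ofReal_mul] at h2
  exact le_of_mul_le_mul_left (by rwa [inv_mul_cancel₀ hs.ne']) (inv_pos.2 hs)

end Program

end RealOps
namespace RealOps

/-! ### Real Choi matrices, separation and strong duality -/

section Duality

/-- A real functional is, on Hermitian matrices, the trace pairing with a Hermitian matrix. -/
lemma exists_isHermitian_trace_mul {n : Type*} [Fintype n] (g : Matrix n n ℂ →ₗ[ℝ] ℝ) :
    ∃ Y : Matrix n n ℂ, Y.IsHermitian ∧ ∀ X : Matrix n n ℂ, X.IsHermitian →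
      (Y * X).trace = g X := by
  classical
  -- Chosen so that `Re tr (Y₀ X) = g X` for every `X`; on Hermitian `X`, the Hermitian part of `Y₀`
  -- turns this into an equality of the trace itself.
  set Y₀ : Matrix n n ℂ := Matrix.of fun j i =>
    (g (Matrix.single i j 1) : ℂ) - g (Matrix.single i j Complex.I) * Complex.I with hY₀
  have hrep : ∀ X, (Y₀ * X).trace.re = g X := by
    intro X
    have hsingle : ∀ i j, g (Matrix.single i j (X i j)) = (Y₀ j i * X i j).re := by
      intro i j
      have : Matrix.single i j (X i j) = (X i j).re • Matrix.single i j (1 : ℂ) +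
          (X i j).im • Matrix.single i j Complex.I := by
        rw [Matrix.smul_single, Matrix.smul_single, ← Matrix.single_add]
        congr 1
        simp [Complex.re_add_im]
      rw [this, map_add, map_smul, map_smul]
      simp [hY₀]
      ring
    conv_rhs => rw [Matrix.matrix_eq_sum_single X]
    simp only [map_sum, hsingle, Matrix.trace, Matrix.diag_apply, Matrix.mul_apply, Complex.re_sum]
    exact Finset.sum_comm
  refine ⟨(1 / 2 : ℂ) • (Y₀ + Y₀.conjTranspose), ?_, fun X hX => ?_⟩
  · rw [Matrix.IsHermitian, Matrix.conjTranspose_smul, Matrix.conjTranspose_add,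
      Matrix.conjTranspose_conjTranspose, add_comm]
    simp
  · have : (Y₀.conjTranspose * X).trace = star (Y₀ * X).trace := by
      rw [← Matrix.trace_conjTranspose, Matrix.conjTranspose_mul, hX.eq, Matrix.trace_mul_comm]
    rw [Matrix.smul_mul, Matrix.trace_smul, Matrix.add_mul, Matrix.trace_add, this,
      Complex.star_def, Complex.add_conj, hrep]
    simp

lemma posSemidef_map_ofReal {n : Type*} [Fintype n] {N : Matrix n n ℝ} (hN : N.PosSemidef) :
    (N.map Complex.ofReal).PosSemidef := by
  obtain ⟨A, rfl⟩ := exists_conjTranspose_mul_self hN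
  convert Matrix.posSemidef_conjTranspose_mul_self (A.map Complex.ofReal) using 1
  ext i j
  simp [Matrix.mul_apply]

/-- The symmetrization of a Hermitian matrix is positive semidefinite as soon as its quadratic form
is nonnegative on real vectors. -/
lemma posSemidef_add_transpose {n : Type*} [Fintype n] {M : Matrix n n ℂ} (hM : M.IsHermitian)
    (h : ∀ v : n → ℝ, 0 ≤ (M * (Matrix.vecMulVec v v).map Complex.ofReal).trace.re) :
    ((1 / 2 : ℂ) • (M + M.transpose)).PosSemidef := by
  -- For Hermitian `M` the transpose is the entrywise conjugate, so the symmetrization is a real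
  -- matrix, and real test vectors suffice.
  have hre : (1 / 2 : ℂ) • (M + M.transpose) = (M.map Complex.re).map Complex.ofReal := by
    ext i j
    have : M j i = star (M i j) := (hM.apply j i).symm
    simp [this, Complex.add_conj]
  rw [hre]
  refine posSemidef_map_ofReal (Matrix.PosSemidef.of_dotProduct_mulVec_nonneg ?_ fun v => ?_)
  · ext i j
    have : M j i = star (M i j) := (hM.apply j i).symm
    change (M j i).re = (M i j).re
    rw [this, Complex.star_def, Complex.conj_re]
  · refine (h v).trans_eq ?_
    simp only [dotProduct, Matrix.mulVec, Matrix.trace, Matrix.diag_apply, Matrix.mul_apply,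
      Complex.re_sum, Matrix.map_apply, Matrix.vecMulVec_apply, Complex.re_mul_ofReal,
      Finset.mul_sum, star_trivial]
    exact Finset.sum_congr rfl fun i _ => Finset.sum_congr rfl fun j _ => by ring

open scoped MatrixOrder Matrix.Norms.L2Operator in
lemma exists_smul_one_sub_posSemidef {n : Type*} [Fintype n] [DecidableEq n] {H : Matrix n n ℂ}
    (hH : H.IsHermitian) : ∃ c : ℝ, ((c : ℂ) • 1 - H).PosSemidef := by
  refine ⟨‖H‖, ?_⟩
  have := IsSelfAdjoint.le_algebraMap_norm_self (a := H) hH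
  rw [Matrix.le_iff] at this
  have heq : ((‖H‖ : ℝ) : ℂ) • (1 : Matrix n n ℂ) = algebraMap ℝ (Matrix n n ℂ) ‖H‖ := by
    ext i j
    simp [Matrix.algebraMap_matrix_apply, Matrix.one_apply]
  rw [heq]
  exact this

variable {B C : Type*}

/-- The partial trace over the output of a real Choi matrix. -/
def choiMarginal [Fintype C] : Matrix (C × B) (C × B) ℝ →ₗ[ℝ] Matrix B B ℂ where
  toFun J := Matrix.of fun b b' => ((∑ c, J (c, b) (c, b') : ℝ) : ℂ)
  map_add' J J' := by ext; simp [Finset.sum_add_distrib]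
  map_smul' a J := by ext; simp [Finset.mul_sum]

/-- The image of `ρ` under the map with a given real Choi matrix. -/
def choiApply [Fintype B] (ρ : Matrix B B ℂ) : Matrix (C × B) (C × B) ℝ →ₗ[ℝ] Matrix C C ℂ where
  toFun J := Matrix.of fun c c' => ∑ b, ∑ b', (J (c, b) (c', b') : ℂ) * ρ b b'
  map_add' J J' := by ext; simp [Finset.sum_add_distrib, add_mul]
  map_smul' a J := by ext; simp [Finset.mul_sum, mul_assoc]

lemma choiMarginal_apply [Fintype C] (J : Matrix (C × B) (C × B) ℝ) (b b' : B) :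
    choiMarginal J b b' = ((∑ c, J (c, b) (c, b') : ℝ) : ℂ) := rfl

lemma choiApply_apply [Fintype B] (ρ : Matrix B B ℂ) (J : Matrix (C × B) (C × B) ℝ) (c c' : C) :
    choiApply ρ J c c' = ∑ b, ∑ b', (J (c, b) (c', b') : ℂ) * ρ b b' := rfl

/-- This and the next lemma compute the adjoints of `choiMarginal` and `choiApply ρ` for the trace
pairing, so that a separating functional becomes one matrix paired with `J`. -/
lemma trace_one_kronecker_mul [Fintype B] [Fintype C] [DecidableEq C] (W : Matrix B B ℂ) (J : Matrix (C × B) (C × B) ℝ) :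
    (((1 : Matrix C C ℂ) ⊗ₖ W) * J.map Complex.ofReal).trace = (W * choiMarginal J).trace := by
  simp only [Matrix.trace, Matrix.diag_apply, Matrix.mul_apply, Fintype.sum_prod_type,
    Matrix.kroneckerMap_apply, Matrix.one_apply, choiMarginal_apply, Matrix.map_apply,
    ite_mul, one_mul, zero_mul, Finset.sum_ite_irrel, Finset.sum_const_zero, Finset.sum_ite_eq,
    Finset.mem_univ, if_true, Complex.ofReal_sum, Finset.mul_sum]
  rw [Finset.sum_comm]
  exact Finset.sum_congr rfl fun b _ => Finset.sum_comm

lemma trace_kronecker_transpose_mul [Fintype B] [Fintype C] (Y : Matrix C C ℂ) (ρ : Matrix B B ℂ)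
    (J : Matrix (C × B) (C × B) ℝ) :
    ((Y ⊗ₖ ρ.transpose) * J.map Complex.ofReal).trace = (Y * choiApply ρ J).trace := by
  simp only [Matrix.trace, Matrix.diag_apply, Matrix.mul_apply, Fintype.sum_prod_type,
    Matrix.kroneckerMap_apply, choiApply_apply, Matrix.map_apply, Matrix.transpose_apply,
    Finset.mul_sum]
  refine Finset.sum_congr rfl fun c _ => ?_
  rw [Finset.sum_comm]
  refine Finset.sum_congr rfl fun c' _ => ?_
  rw [Finset.sum_comm]
  exact Finset.sum_congr rfl fun b _ => Finset.sum_congr rfl fun b' _ => by ring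

lemma trace_choiMarginal [Fintype B] [Fintype C] (J : Matrix (C × B) (C × B) ℝ) :
    (choiMarginal J).trace = (J.trace : ℂ) := by
  simp only [Matrix.trace, Matrix.diag_apply, choiMarginal_apply, Fintype.sum_prod_type,
    Complex.ofReal_sum]
  exact Finset.sum_comm

lemma choiMarginal_isHermitian [Fintype C] {J : Matrix (C × B) (C × B) ℝ} (hJ : J.IsHermitian) :
    (choiMarginal J).IsHermitian := by
  ext b b'
  simp only [Matrix.conjTranspose_apply, choiMarginal_apply, Complex.star_def, Complex.conj_ofReal]
  congr 1
  exact Finset.sum_congr rfl fun c _ => by simpa using hJ.apply (c, b) (c, b')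

lemma choiApply_isHermitian [Fintype B] {ρ : Matrix B B ℂ} (hρ : ρ.IsHermitian)
    {J : Matrix (C × B) (C × B) ℝ} (hJ : J.IsHermitian) : (choiApply ρ J).IsHermitian := by
  ext c c'
  simp only [Matrix.conjTranspose_apply, choiApply_apply, star_sum, star_mul', Complex.star_def,
    Complex.conj_ofReal]
  rw [Finset.sum_comm]
  refine Finset.sum_congr rfl fun b _ => Finset.sum_congr rfl fun b' _ => ?_
  rw [← hρ.apply b b', ← hJ.apply (c, b) (c', b')]
  simp

/-- A real positive semidefinite Choi matrix with the right marginal is a real channel. -/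
lemma exists_isRealCPTP_of_choi [Fintype B] [Fintype C] [DecidableEq B] {ρ : Matrix B B ℂ} {J : Matrix (C × B) (C × B) ℝ}
    (hJ : J.PosSemidef) (htr : choiMarginal J = 1) :
    ∃ E : Matrix B B ℂ →ₗ[ℂ] Matrix C C ℂ, IsRealCPTP E ∧ E ρ = choiApply ρ J := by
  obtain ⟨A, hA⟩ := exists_conjTranspose_mul_self hJ
  have hJA : ∀ x y, (J x y : ℂ) = ∑ l, (A l x : ℂ) * A l y := fun x y => by
    simp [hA, Matrix.mul_apply]
  let e := Fintype.equivFin (C × B)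
  -- Each row of the real factor `A` in `J = Aᵀ A`, reshaped, is a Kraus operator.
  let K : Fin (Fintype.card (C × B)) → Matrix C B ℂ := fun l =>
    Matrix.of fun c b => (A (e.symm l) (c, b) : ℂ)
  have happly : ∀ X, krausMap K X = choiApply X J := by
    intro X
    ext c c'
    simp only [krausMap_apply, Matrix.sum_apply, Matrix.mul_apply, Matrix.conjTranspose_apply,
      choiApply_apply, hJA, Finset.sum_mul, Complex.star_def, K, Matrix.of_apply,
      Complex.conj_ofReal]
    rw [Equiv.sum_comp e.symm fun l => ∑ b', ∑ b, (A l (c, b) : ℂ) * X b b' * A l (c', b')]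
    rw [Finset.sum_comm]
    conv_rhs => rw [Finset.sum_comm]
    refine Finset.sum_congr rfl fun b' _ => ?_
    rw [Finset.sum_comm]
    exact Finset.sum_congr rfl fun b _ => Finset.sum_congr rfl fun l _ => by ring
  refine ⟨krausMap K, ⟨⟨fun k X hX => blockMap_krausMap_posSemidef K hX, fun X => ?_⟩,
    _, K, fun l i j => Complex.ofReal_im _, fun X => rfl⟩, happly ρ⟩
  have h1 : (choiApply X J).trace = ((choiMarginal J).transpose * X).trace := by
    simp only [Matrix.trace, Matrix.diag_apply, Matrix.mul_apply, Matrix.transpose_apply,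
      choiApply_apply, choiMarginal_apply, Complex.ofReal_sum, Finset.sum_mul]
    rw [Finset.sum_comm]
    conv_rhs => rw [Finset.sum_comm]
    exact Finset.sum_congr rfl fun b _ => Finset.sum_comm
  rw [happly, h1, htr, Matrix.transpose_one, one_mul]

instance {m n : Type*} : LocallyConvexSpace ℝ (Matrix m n ℂ) :=
  inferInstanceAs (LocallyConvexSpace ℝ (m → n → ℂ))

instance {m n : Type*} : ContinuousSMul ℝ (Matrix m n ℂ) :=
  inferInstanceAs (ContinuousSMul ℝ (m → n → ℂ))

/-- If no real Choi matrix achieves `ρ ↦ σ`, some pair of Hermitian matrices witnesses it. -/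
lemma exists_separating [Fintype B] [Fintype C] [DecidableEq B] [Nonempty B] {ρ : Matrix B B ℂ} {σ : Matrix C C ℂ}
    (hρ : ρ.IsHermitian) (hσ : σ.IsHermitian)
    (hno : ∀ J : Matrix (C × B) (C × B) ℝ, J.PosSemidef → choiMarginal J = 1 →
      choiApply ρ J ≠ σ) :
    ∃ (W : Matrix B B ℂ) (Y : Matrix C C ℂ) (w y : ℝ), W.IsHermitian ∧ Y.IsHermitian ∧
      W.trace = w ∧ (Y * σ).trace = y ∧ w + y < 0 ∧
      ∀ v : C × B → ℝ, 0 ≤ ((W * choiMarginal (Matrix.vecMulVec v v)).trace +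
        (Y * choiApply ρ (Matrix.vecMulVec v v)).trace).re := by
  set d : ℝ := (Fintype.card B : ℝ) with hd
  have hd0 : 0 < d := by rw [hd]; exact_mod_cast Fintype.card_pos
  -- Marginal 1 forces trace `d`. Keeping only the trace condition gives a compact convex base of
  -- the cone, so its image is closed and can be strictly separated from `(1, σ)`.
  set S : Set (Matrix (C × B) (C × B) ℝ) := {J | J.PosSemidef ∧ J.trace = d} with hS
  have hScomp : IsCompact S := by
    refine (isCompact_posSemidef_trace_le d).of_isClosed_subset
      (isClosed_posSemidef.inter (isClosed_eq continuous_id.matrix_trace continuous_const)) ?_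
    rintro J ⟨hJ, h⟩
    exact ⟨hJ, h.le⟩
  have hSconv : Convex ℝ S := by
    rintro J ⟨hJ, h⟩ J' ⟨hJ', h'⟩ a b ha hb hab
    refine ⟨(hJ.smul ha).add (hJ'.smul hb), ?_⟩
    rw [Matrix.trace_add, Matrix.trace_smul, Matrix.trace_smul, h, h', ← add_smul, hab, one_smul]
  set Φ := (choiMarginal (B := B) (C := C)).prod (choiApply (C := C) ρ) with hΦ
  have hΦc : Continuous Φ := Φ.continuous_of_finiteDimensional
  have hnot : ((1, σ) : Matrix B B ℂ × Matrix C C ℂ) ∉ Φ '' S := by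
    rintro ⟨J, ⟨hJ, -⟩, h⟩
    exact hno J hJ (congrArg Prod.fst h) (congrArg Prod.snd h)
  obtain ⟨f, u, hlt, hgt⟩ := geometric_hahn_banach_point_closed (hSconv.linear_image Φ)
    (hScomp.image hΦc).isClosed hnot
  obtain ⟨W, hW, hWg⟩ := exists_isHermitian_trace_mul
    ((f : _ →ₗ[ℝ] ℝ) ∘ₗ LinearMap.inl ℝ (Matrix B B ℂ) (Matrix C C ℂ))
  obtain ⟨Y, hY, hYg⟩ := exists_isHermitian_trace_mul
    ((f : _ →ₗ[ℝ] ℝ) ∘ₗ LinearMap.inr ℝ (Matrix B B ℂ) (Matrix C C ℂ))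
  have hf : ∀ X X', f (X, X') = f (X, 0) + f (0, X') := fun X X' => by
    rw [← map_add]; simp
  simp only [LinearMap.comp_apply, LinearMap.inl_apply, LinearMap.inr_apply,
    ContinuousLinearMap.coe_coe] at hWg hYg
  -- On trace `d` the threshold `u` equals `(u / d) * tr J`; absorbing it into `W` makes the
  -- inequality homogeneous, hence valid on all rank-one `vvᵀ`.
  refine ⟨W - ((u / d : ℝ) : ℂ) • 1, Y, f (1, 0) - u, f (0, σ), ?_, hY, ?_, hYg σ hσ, ?_, ?_⟩
  · refine hW.sub ?_
    rw [Matrix.IsHermitian, Matrix.conjTranspose_smul, Matrix.conjTranspose_one]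
    simp
  · have := hWg 1 Matrix.isHermitian_one
    rw [Matrix.mul_one] at this
    rw [Matrix.trace_sub, this, Matrix.trace_smul, Matrix.trace_one, smul_eq_mul,
      ← Complex.ofReal_natCast, ← Complex.ofReal_mul, ← hd, div_mul_cancel₀ _ hd0.ne',
      Complex.ofReal_sub]
  · rw [hf] at hlt
    linarith
  · intro v
    set J := Matrix.vecMulVec v v with hJ
    have hJp : J.PosSemidef := by
      simpa using Matrix.posSemidef_vecMulVec_self_star v
    have hJt : 0 ≤ J.trace := hJp.trace_nonneg
    have key : J.trace * (u / d) ≤ f (Φ J) := by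
      rcases hJt.eq_or_lt with h0 | hpos
      · rw [hJp.trace_eq_zero_iff.1 h0.symm]
        simp
      · have hmem : (d / J.trace) • J ∈ S := by
          refine ⟨hJp.smul (by positivity), ?_⟩
          rw [Matrix.trace_smul, smul_eq_mul, div_mul_cancel₀ _ hpos.ne']
        have := hgt _ ⟨_, hmem, rfl⟩
        rw [map_smul, map_smul, smul_eq_mul] at this
        calc J.trace * (u / d) ≤ J.trace * (d / J.trace * f (Φ J) / d) := by gcongr
          _ = f (Φ J) := by field_simp
    have hΦJ : f (Φ J) = f (choiMarginal J, 0) + f (0, choiApply ρ J) := hf _ _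
    rw [Matrix.sub_mul, Matrix.trace_sub, hWg _ (choiMarginal_isHermitian hJp.1),
      hYg _ (choiApply_isHermitian hρ hJp.1), Matrix.smul_mul, Matrix.trace_smul, Matrix.one_mul,
      trace_choiMarginal, smul_eq_mul, ← Complex.ofReal_mul, ← Complex.ofReal_sub,
      ← Complex.ofReal_add, Complex.ofReal_re]
    linarith

/-- Strong duality: if the program has value one, there is a real channel. -/
lemma exists_isRealCPTP [Fintype B] [Fintype C] [DecidableEq B] [DecidableEq C] [Nonempty B] [Nonempty C]
    {ρ : Matrix B B ℂ} {σ : Matrix C C ℂ} (hρ : IsDensity ρ) (hσ : IsDensity σ)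
    (H : ∀ X₁ X₂ Z, Feasible ρ σ 1 X₁ X₂ Z → 1 ≤ Z.trace.re) :
    ∃ E : Matrix B B ℂ →ₗ[ℂ] Matrix C C ℂ, IsRealCPTP E ∧ E ρ = σ := by
  by_contra hE
  obtain ⟨W, Y, w, y, hW, hY, hw, hy, hwy, hv⟩ := exists_separating hρ.1.1 hσ.1.1
    fun J hJ htr hJσ => by
      obtain ⟨E, hE1, hE2⟩ := exists_isRealCPTP_of_choi (ρ := ρ) hJ htr
      exact hE ⟨E, hE1, hE2.trans hJσ⟩
  set M : Matrix (C × B) (C × B) ℂ := (1 : Matrix C C ℂ) ⊗ₖ W + Y ⊗ₖ ρ.transpose with hM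
  have hMh : M.IsHermitian := by
    rw [Matrix.IsHermitian, hM, Matrix.conjTranspose_add, Matrix.conjTranspose_kronecker,
      Matrix.conjTranspose_kronecker, hW.eq, hY.eq, Matrix.conjTranspose_one,
      hρ.1.transpose.1.eq]
  have hMp := posSemidef_add_transpose hMh fun v => by
    rw [hM, Matrix.add_mul, Matrix.trace_add, trace_one_kronecker_mul,
      trace_kronecker_transpose_mul]
    exact hv v
  have hYh : ((1 / 2 : ℂ) • Y).IsHermitian := by
    rw [Matrix.IsHermitian, Matrix.conjTranspose_smul, hY.eq]
    simp
  obtain ⟨c, hc⟩ := exists_smul_one_sub_posSemidef hYh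
  -- The shift by `c` makes the `X` components positive. Its contributions cancel in the slack,
  -- which is exactly `½(M + Mᵀ)`, and add `2c` to both the objective and the normalisation.
  have hfeas : Feasible ρ σ (2 * c - y) ((c : ℂ) • 1 - (1 / 2 : ℂ) • Y).transpose
      ((c : ℂ) • 1 - (1 / 2 : ℂ) • Y)
      ((1 / 2 : ℂ) • (W + W.transpose) + (c : ℂ) • (ρ + ρ.transpose)) := by
    refine ⟨hc.transpose, hc, ?_, ?_⟩
    · convert hMp using 1
      ext x z
      simp [hM, Matrix.one_apply, eq_comm (a := z.1)]
      split_ifs <;> ring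
    · have h1 : (σ.transpose * Y.transpose).trace = y := by
        rw [← Matrix.transpose_mul, Matrix.trace_transpose, hy]
      have h2 : (σ * Y).trace = y := by rw [Matrix.trace_mul_comm, hy]
      simp [Matrix.mul_sub, Matrix.trace_sub, Matrix.trace_add, h1, h2, hσ.2]
      ring
  have htr : ((1 / 2 : ℂ) • (W + W.transpose) + (c : ℂ) • (ρ + ρ.transpose)).trace.re
      = w + 2 * c := by
    simp [Matrix.trace_add, hw, hρ.2]
    ring
  -- With `w + y < 0` this makes the normalisation `2c - y` positive, so rescaling is allowed; it
  -- gives `2c - y ≤ w + 2c`, contradicting `w + y < 0`.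
  have h0 : 0 ≤ w + 2 * c := by
    rw [← htr]
    exact (Complex.le_def.1 (hfeas.posSemidef hρ.1).trace_nonneg).1
  have := hfeas.le_trace H (by linarith)
  rw [htr] at this
  linarith

end Duality

end RealOps

/-! ### The cycle of implications -/

theorem mainTheorem8 {B : Type*} {C : Type*} [Fintype B] [Fintype C]
    [DecidableEq C] (ρ : Matrix B B ℂ) (σ : Matrix C C ℂ)
    (hρ : RealOps.IsDensity ρ) (hσ : RealOps.IsDensity σ) :
    ∃ α : ℝ, IsLeast (RealOps.sdpValues ρ σ) α ∧
      List.TFAE [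
        ∃ E : Matrix B B ℂ →ₗ[ℂ] Matrix C C ℂ, RealOps.IsRealCPTP E ∧ E ρ = σ,
        ∀ ω₁ ω₂ : Matrix C C ℂ, RealOps.IsDensity ω₁ → RealOps.IsDensity ω₂ →
          ((RealOps.maxEntangledOverlap
              (RealOps.marginalAC (RealOps.Omega ω₁ ω₂ ρ σ)) : ℝ) : EReal) ≤
            ((RealOps.twoPow (-RealOps.condMinEntropy
              (RealOps.marginalAB (RealOps.Omega ω₁ ω₂ ρ σ))) : ENNReal) : EReal),
        ∀ ω₁ ω₂ : Matrix C C ℂ, RealOps.IsDensity ω₁ → RealOps.IsDensity ω₂ →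
          RealOps.condMinEntropy (RealOps.marginalAB (RealOps.Omega ω₁ ω₂ ρ σ)) ≤
            RealOps.condMinEntropy (RealOps.marginalAC (RealOps.Omega ω₁ ω₂ ρ σ)),
        ∀ ω₁ ω₂ : Matrix C C ℂ,
          RealOps.condMinEntropy (RealOps.marginalAB (RealOps.Omega ω₁ ω₂ ρ σ)) ≤
            RealOps.condMinEntropy (RealOps.marginalAC (RealOps.Omega ω₁ ω₂ ρ σ)),
        α = 1] := by
  classical
  have hB : Nonempty B := by
    by_contra h
    rw [not_nonempty_iff] at h
    simpa [Matrix.trace_eq_zero_of_isEmpty] using hρ.2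
  have hC : Nonempty C := by
    by_contra h
    rw [not_nonempty_iff] at h
    simpa [Matrix.trace_eq_zero_of_isEmpty] using hσ.2
  obtain ⟨α, hα, hα1⟩ := RealOps.exists_isLeast_sdpValues hρ hσ
  refine ⟨α, hα, ?_⟩
  tfae_have 1 → 4 := fun ⟨E, hE, hEρ⟩ ω₁ ω₂ =>
    RealOps.condMinEntropy_le_condMinEntropy
      (RealOps.minTrace_marginalAC_le hE hρ.2 hσ.2 hEρ ω₁ ω₂)
  tfae_have 4 → 3 := fun h ω₁ ω₂ _ _ => h ω₁ ω₂
  tfae_have 3 → 2 := fun h ω₁ ω₂ h₁ h₂ => by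
    rw [RealOps.twoPow_neg_condMinEntropy]
    refine le_trans ?_ (EReal.coe_ennreal_le_coe_ennreal_iff.2
      ((RealOps.maxEntangledOverlap_le_minTrace _).trans
        (RealOps.minTrace_le_of_condMinEntropy_le (h ω₁ ω₂ h₁ h₂))))
    -- `ENNReal.ofReal` truncates at zero, which is harmless here: the overlap is at most its
    -- positive part.
    rw [EReal.coe_ennreal_ofReal]
    exact_mod_cast le_max_left _ _
  tfae_have 2 → 5 := fun h => by
    simp only [RealOps.twoPow_neg_condMinEntropy] at h
    exact (RealOps.isLeast_eq_one_iff hρ hα hα1).2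
      fun _ _ _ hf => RealOps.one_le_trace_of_overlap_le hρ hσ h hf
  tfae_have 5 → 1 := fun h =>
    RealOps.exists_isRealCPTP hρ hσ ((RealOps.isLeast_eq_one_iff hρ hα hα1).1 h)
  tfae_finish
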